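/- Let $k \ge 3$ be an integer, and let $M(2k)$ be the perfect matching derangement graph: its vertices are the perfect matchings of the complete graph $K_{2k}$, and two distinct perfect matchings are adjacent if and only if they have no edge in common. Then the automorphism group of $M(2k)$ is isomorphic, as a group, to the symmetric group $\mathrm{Sym}(2k)$ on $2k$ points. -/

import Mathlib

/-- The perfect matchings of the complete graph on `2 * k` vertices. -/
abbrev PerfectMatching (k : ℕ) : Type :=
  {P : (SimpleGraph.completeGraph (Fin (2 * k))).Subgraph // P.IsPerfectMatching}

/-- The perfect matching derangement graph `M(2k)`: its vertices are the perfect matchings of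
the complete graph on `2 * k` vertices, two of them being adjacent when they have no edge in common.
The condition `P ≠ Q` only matters for `k = 0`. -/
def matchingDerangementGraph (k : ℕ) : SimpleGraph (PerfectMatching k) where
  Adj P Q := P ≠ Q ∧ Disjoint P.1.edgeSet Q.1.edgeSet
  symm := ⟨fun _ _ h => ⟨h.1.symm, h.2.symm⟩⟩
  loopless := ⟨fun _ h => h.1 rfl⟩

/-! Perfect matchings are treated as fixed-point-free involutions. The families `withEdge a b` can
be recognised from the graph alone: they are exactly the dominating cocliques. An automorphism
therefore permutes them, and with them the edges of the complete graph. Two distinct edges are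
disjoint exactly when some perfect matching contains both, so meeting edges go to meeting edges. The
edges at a point, at least five of them, then go to edges through one point, and the resulting map
on points is a permutation inducing the automorphism.

The recognition (`IsDominatingCoclique.exists_eq_withEdge`) rests on flexibility: as soon as four
points remain, they can be matched while avoiding two given partial matchings. For a member `P₀` of
a dominating coclique `F`, one finds a set of edges of `P₀` all of whose extensions lie in `F`, then
shrinks it to a single edge. Six points leave too little room to find such a set and are handled by
hand. -/

/-- At least four distinct edges which meet pairwise have a common point. -/
theorem Sym2.exists_mem_of_pairwise_meet {ι V : Type*} [DecidableEq ι] (s : Finset ι)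
    (hs : 4 ≤ s.card) (e : ι → Sym2 V) (hne : ∀ i ∈ s, ∀ j ∈ s, i ≠ j → e i ≠ e j)
    (hmeet : ∀ i ∈ s, ∀ j ∈ s, i ≠ j → ∃ v, v ∈ e i ∧ v ∈ e j) : ∃ x, ∀ i ∈ s, x ∈ e i := by
  -- An edge missing `x` but meeting three distinct edges through `x` would need three distinct
  -- endpoints.
  have key : ∀ i ∈ s, ∀ j ∈ s, ∀ k ∈ s, i ≠ j → i ≠ k → j ≠ k → ∀ x, x ∈ e i → x ∈ e j → x ∈ e k →
      ∃ x, ∀ i ∈ s, x ∈ e i := by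
    intro i hi j hj k hk hij hik hjk x hxi hxj hxk
    refine ⟨x, fun l hl => ?_⟩
    by_contra hxl
    have hmem : ∀ m ∈ s, x ∈ e m → ∃ y ∈ e l, e m = s(x, y) := by
      intro m hm hxm
      obtain ⟨v, hv, hv'⟩ := hmeet m hm l hl (by rintro rfl; exact hxl hxm)
      have hvx : x ≠ v := by rintro rfl; exact hxl hv'
      exact ⟨v, hv', (Sym2.mem_and_mem_iff hvx).mp ⟨hxm, hv⟩⟩
    obtain ⟨y, hy, hiy⟩ := hmem i hi hxi
    obtain ⟨z, hz, hjz⟩ := hmem j hj hxj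
    obtain ⟨w, hw, hkw⟩ := hmem k hk hxk
    have hyz : y ≠ z := by rintro rfl; exact hne i hi j hj hij (hiy.trans hjz.symm)
    have hyw : y ≠ w := by rintro rfl; exact hne i hi k hk hik (hiy.trans hkw.symm)
    have hzw : z ≠ w := by rintro rfl; exact hne j hj k hk hjk (hjz.trans hkw.symm)
    rw [(Sym2.mem_and_mem_iff hyz).mp ⟨hy, hz⟩, Sym2.mem_iff] at hw
    rcases hw with h | h
    exacts [hyw h.symm, hzw h.symm]
  obtain ⟨t, hts, ht⟩ := Finset.exists_subset_card_eq hs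
  obtain ⟨i, j, k, l, hij, hik, hil, hjk, hjl, hkl, rfl⟩ := Finset.card_eq_four.mp ht
  have hi := hts (show i ∈ _ by simp)
  have hj := hts (show j ∈ _ by simp)
  have hk := hts (show k ∈ _ by simp)
  have hl := hts (show l ∈ _ by simp)
  obtain ⟨x, hxi, hxj⟩ := hmeet i hi j hj hij
  by_cases hxk : x ∈ e k
  · exact key i hi j hj k hk hij hik hjk x hxi hxj hxk
  by_cases hxl : x ∈ e l
  · exact key i hi j hj l hl hij hil hjl x hxi hxj hxl
  obtain ⟨y, hy⟩ := Sym2.mem_iff_exists.mp hxi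
  obtain ⟨z, hz⟩ := Sym2.mem_iff_exists.mp hxj
  have hyz : y ≠ z := by rintro rfl; exact hne i hi j hj hij (hy.trans hz.symm)
  -- An edge missing `x` must be the third side of the triangle, so `e k` and `e l` would coincide.
  have hopp : ∀ m ∈ s, x ∉ e m → e m = s(y, z) := by
    intro m hm hxm
    obtain ⟨v, hv, hv'⟩ := hmeet i hi m hm (by rintro rfl; exact hxm hxi)
    obtain ⟨w, hw, hw'⟩ := hmeet j hj m hm (by rintro rfl; exact hxm hxj)
    rw [hy, Sym2.mem_iff] at hv
    rw [hz, Sym2.mem_iff] at hw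
    rcases hv with rfl | rfl
    · exact (hxm hv').elim
    rcases hw with rfl | rfl
    · exact (hxm hw').elim
    exact (Sym2.mem_and_mem_iff hyz).mp ⟨hv', hw'⟩
  exact (hne k hk l hl hkl ((hopp k hk hxk).trans (hopp l hl hxl).symm)).elim

/-- An even set with at least four elements has a perfect matching avoiding two given
partial matchings. -/
theorem exists_involution_on_avoiding {V : Type*} [DecidableEq V] {f g : V → V}
    (hf : ∀ x, f (f x) = x) (hg : ∀ x, g (g x) = x) (n : ℕ) (W : Finset V)
    (hW : W.card = 2 * n + 4) :
    ∃ h : V → V, ∀ x ∈ W, h x ∈ W ∧ h (h x) = x ∧ h x ≠ x ∧ h x ≠ f x ∧ h x ≠ g x := by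
  induction n generalizing W with
  | zero =>
    have key : ∀ a b c d : V, a ≠ b → a ≠ c → a ≠ d → b ≠ c → b ≠ d → c ≠ d →
        W = {a, b, c, d} → f a ≠ b → f c ≠ d → g a ≠ b → g c ≠ d →
        ∃ h : V → V, ∀ x ∈ W, h x ∈ W ∧ h (h x) = x ∧ h x ≠ x ∧ h x ≠ f x ∧ h x ≠ g x := by
      intro a b c d hab hac had hbc hbd hcd hW h1 h2 h3 h4
      refine ⟨fun x => if x = a then b else if x = b then a else if x = c then d else c, ?_⟩
      have h1' : f b ≠ a := fun h => h1 (by rw [← h, hf])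
      have h2' : f d ≠ c := fun h => h2 (by rw [← h, hf])
      have h3' : g b ≠ a := fun h => h3 (by rw [← h, hg])
      have h4' : g d ≠ c := fun h => h4 (by rw [← h, hg])
      subst hW
      intro x hx
      simp only [Finset.mem_insert, Finset.mem_singleton] at hx
      rcases hx with rfl | rfl | rfl | rfl <;> simp <;> grind
    obtain ⟨a, b, c, d, hab, hac, had, hbc, hbd, hcd, rfl⟩ := Finset.card_eq_four.mp hW
    -- Four points have three perfect matchings. The edges of `f` inside `W` all lie in one of them,
    -- likewise for `g`, so at least one of the three is unobstructed.
    by_cases h1 : f a ≠ b ∧ f c ≠ d ∧ g a ≠ b ∧ g c ≠ d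
    · exact key a b c d hab hac had hbc hbd hcd rfl h1.1 h1.2.1 h1.2.2.1 h1.2.2.2
    by_cases h2 : f a ≠ c ∧ f b ≠ d ∧ g a ≠ c ∧ g b ≠ d
    · exact key a c b d hac hab had hbc.symm hcd hbd (by grind) h2.1 h2.2.1 h2.2.2.1 h2.2.2.2
    have h3 : f a ≠ d ∧ f b ≠ c ∧ g a ≠ d ∧ g b ≠ c := by
      have := hf a; have := hf b; have := hf c; have := hf d
      have := hg a; have := hg b; have := hg c; have := hg d
      grind
    exact key a d b c had hab hac hbd.symm hcd.symm hbc (by grind) h3.1 h3.2.1 h3.2.2.1 h3.2.2.2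
  | succ n ih =>
    obtain ⟨x, hx⟩ : W.Nonempty := Finset.card_pos.mp (by omega)
    obtain ⟨y, hy, hy'⟩ : ∃ y ∈ W, y ∉ ({x, f x, g x} : Finset V) :=
      Finset.exists_mem_notMem_of_card_lt_card (Finset.card_le_three.trans_lt (by omega))
    simp only [Finset.mem_insert, Finset.mem_singleton, not_or] at hy'
    obtain ⟨hyx, hyf, hyg⟩ := hy'
    obtain ⟨h, hh⟩ := ih ((W.erase x).erase y) (by
      rw [Finset.card_erase_of_mem (Finset.mem_erase.mpr ⟨hyx, hy⟩), Finset.card_erase_of_mem hx]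
      omega)
    have hf' : x ≠ f y := fun e => hyf (by rw [e, hf])
    have hg' : x ≠ g y := fun e => hyg (by rw [e, hg])
    refine ⟨fun z => if z = x then y else if z = y then x else h z, fun z hz => ?_⟩
    by_cases hzx : z = x
    · subst hzx; simp [hyx, hy, hyf, hyg]
    by_cases hzy : z = y
    · subst hzy; simp [hyx, hx, hf', hg', Ne.symm hyx]
    have := hh z (by simp [hzx, hzy, hz])
    simp only [Finset.mem_erase] at this
    simp [hzx, hzy, this]

/-- The fixed-point-free involutions of `V`. -/
abbrev FixedPointFreeInvolution (V : Type*) : Type _ :=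
  {f : Equiv.Perm V // (∀ x, f (f x) = x) ∧ ∀ x, f x ≠ x}

namespace FixedPointFreeInvolution

variable {V : Type*}

/-- The graph on the fixed-point-free involutions of `V` in which two of them are adjacent when
they are distinct and agree nowhere. -/
def derangementGraph (V : Type*) : SimpleGraph (FixedPointFreeInvolution V) where
  Adj P Q := P ≠ Q ∧ ∀ x, P.1 x ≠ Q.1 x
  symm := ⟨fun _ _ h => ⟨h.1.symm, fun x => (h.2 x).symm⟩⟩
  loopless := ⟨fun _ h => h.1 rfl⟩

theorem derangementGraph_adj [Nonempty V] {P Q : FixedPointFreeInvolution V} :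
    (derangementGraph V).Adj P Q ↔ ∀ x, P.1 x ≠ Q.1 x :=
  ⟨fun h => h.2, fun h => ⟨fun e => h (Classical.arbitrary V) (by rw [e]), h⟩⟩

theorem apply_eq_comm (P : FixedPointFreeInvolution V) {a b : V} : P.1 a = b ↔ P.1 b = a :=
  ⟨fun h => by rw [← h, P.2.1], fun h => by rw [← h, P.2.1]⟩

/-! ### Extending partial matchings -/

section Existence

variable [Fintype V] [DecidableEq V]

/-- On the complement of a `P`-invariant set `A` the involution `P` can be changed so as to avoid
two given partial matchings there. -/
theorem exists_eq_on_avoiding {f g P : V → V} (hf : ∀ x, f (f x) = x) (hg : ∀ x, g (g x) = x)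
    (hV : Even (Fintype.card V)) (A : Finset V) (hA : ∀ x ∈ A, P x ∈ A ∧ P (P x) = x ∧ P x ≠ x)
    (hAe : Even A.card) (hc : A.card + 4 ≤ Fintype.card V) :
    ∃ R : FixedPointFreeInvolution V, (∀ x ∈ A, R.1 x = P x) ∧
      ∀ x ∉ A, R.1 x ≠ f x ∧ R.1 x ≠ g x := by
  have hcard := Finset.card_compl A
  obtain ⟨h, hh⟩ := exists_involution_on_avoiding hf hg ((Fintype.card V - A.card - 4) / 2) Aᶜ
    (by obtain ⟨i, hi⟩ := hV; obtain ⟨j, hj⟩ := hAe; omega)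
  simp only [Finset.mem_compl] at hh
  let r : V → V := fun x => if x ∈ A then P x else h x
  have hr : ∀ x, r (r x) = x := by
    intro x
    by_cases hx : x ∈ A
    · simp [r, hx, hA x hx]
    · simp [r, hx, hh x hx]
  refine ⟨⟨Function.Involutive.toPerm r hr, hr, fun x => ?_⟩, fun x hx => ?_, fun x hx => ?_⟩
  · change r x ≠ x
    by_cases hx : x ∈ A
    · simp [r, hx, hA x hx]
    · simp [r, hx, hh x hx]
  · change r x = P x
    simp [r, hx]
  · change r x ≠ f x ∧ r x ≠ g x
    simp [r, hx, hh x hx]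

/-- A perfect matching containing a given edge and avoiding two partial matchings. -/
theorem exists_apply_eq_avoiding {f g : V → V} (hf : ∀ x, f (f x) = x) (hg : ∀ x, g (g x) = x)
    (hV : Even (Fintype.card V)) (hc : 6 ≤ Fintype.card V) {a b : V} (hab : a ≠ b)
    (hfa : f a ≠ b) (hga : g a ≠ b) :
    ∃ R : FixedPointFreeInvolution V, R.1 a = b ∧ ∀ x, R.1 x ≠ f x ∧ R.1 x ≠ g x := by
  have h2 : ({a, b} : Finset V).card = 2 := Finset.card_pair hab
  obtain ⟨R, hR, hR'⟩ := exists_eq_on_avoiding (P := Equiv.swap a b) hf hg hV {a, b}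
    (by simp [hab, Ne.symm hab]) (by simp [h2]) (by omega)
  have hRa : R.1 a = b := by simpa using hR a (by simp)
  refine ⟨R, hRa, fun x => ?_⟩
  by_cases hxa : x = a
  · subst hxa; rw [hRa]; exact ⟨hfa.symm, hga.symm⟩
  by_cases hxb : x = b
  · subst hxb
    rw [R.apply_eq_comm.mp hRa]
    exact ⟨fun e => hfa (by rw [e, hf]), fun e => hga (by rw [e, hg])⟩
  exact hR' x (by simp [hxa, hxb])

end Existence

/-! ### Edge families and dominating cocliques -/

/-- The perfect matchings containing the edge `{a, b}`. -/
def withEdge (a b : V) : Set (FixedPointFreeInvolution V) := {P | P.1 a = b}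

theorem withEdge_comm (a b : V) : withEdge a b = withEdge b a := Set.ext fun P => P.apply_eq_comm

theorem withEdge_congr {a b c d : V} (h : s(a, b) = s(c, d)) : withEdge a b = withEdge c d := by
  rcases Sym2.eq_iff.mp h with ⟨rfl, rfl⟩ | ⟨rfl, rfl⟩
  exacts [rfl, withEdge_comm _ _]

/-- A coclique such that any two vertices outside it have a common neighbour in it. -/
structure IsDominatingCoclique {α : Type*} (G : SimpleGraph α) (F : Set α) : Prop where
  not_adj : ∀ P ∈ F, ∀ Q ∈ F, ¬ G.Adj P Q
  exists_adj : ∀ Q₁ ∉ F, ∀ Q₂ ∉ F, ∃ P ∈ F, G.Adj P Q₁ ∧ G.Adj P Q₂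

theorem IsDominatingCoclique.image {α : Type*} {G : SimpleGraph α} {F : Set α}
    (h : IsDominatingCoclique G F) (φ : G ≃g G) : IsDominatingCoclique G (φ '' F) where
  not_adj := by
    rintro _ ⟨P, hP, rfl⟩ _ ⟨Q, hQ, rfl⟩ hadj
    exact h.not_adj P hP Q hQ (φ.map_adj_iff.mp hadj)
  exists_adj := by
    intro Q₁ h₁ Q₂ h₂
    obtain ⟨P, hP, hP₁, hP₂⟩ := h.exists_adj (φ.symm Q₁) (fun h => h₁ ⟨_, h, by simp⟩)
      (φ.symm Q₂) (fun h => h₂ ⟨_, h, by simp⟩)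
    refine ⟨φ P, ⟨P, hP, rfl⟩, ?_, ?_⟩
    · simpa using φ.map_adj_iff.mpr hP₁
    · simpa using φ.map_adj_iff.mpr hP₂

/-- Domination with `Q₁ = Q₂` gives every outside vertex a neighbour in `F`, so `F` is a maximal
coclique. -/
theorem IsDominatingCoclique.eq_of_subset {α : Type*} {G : SimpleGraph α} {F F' : Set α}
    (h : IsDominatingCoclique G F) (hF' : ∀ P ∈ F', ∀ Q ∈ F', ¬ G.Adj P Q) (hs : F ⊆ F') :
    F = F' := by
  refine hs.antisymm fun Q hQ => ?_
  by_contra hQF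
  obtain ⟨P, hP, hPQ, -⟩ := h.exists_adj Q hQF Q hQF
  exact hF' P (hs hP) Q hQ hPQ

theorem not_adj_of_mem_withEdge {a b : V} (P : FixedPointFreeInvolution V) (hP : P ∈ withEdge a b)
    (Q : FixedPointFreeInvolution V) (hQ : Q ∈ withEdge a b) : ¬ (derangementGraph V).Adj P Q :=
  fun h => h.2 a (Eq.trans hP (Eq.symm hQ))

theorem IsDominatingCoclique.exists_agree [Nonempty V] {F : Set (FixedPointFreeInvolution V)}
    (hF : IsDominatingCoclique (derangementGraph V) F) {P Q : FixedPointFreeInvolution V}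
    (hP : P ∈ F) (hQ : Q ∈ F) : ∃ x, P.1 x = Q.1 x := by
  have := hF.not_adj P hP Q hQ
  rw [derangementGraph_adj] at this
  push Not at this
  exact this

theorem even_card_of_invariant (P : FixedPointFreeInvolution V) (A : Finset V)
    (hA : ∀ x ∈ A, P.1 x ∈ A) : Even A.card := by
  have h : ∑ _x ∈ A, (1 : ZMod 2) = 0 :=
    Finset.sum_involution (fun x _ => P.1 x) (fun _ _ => by decide) (fun x _ _ => P.2.2 x)
      hA (fun x _ => P.2.1 x)
  rw [← ZMod.natCast_eq_zero_iff_even]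
  simpa using h

/-! ### Classification of dominating cocliques -/

section Classification

variable [Fintype V]

theorem isDominatingCoclique_withEdge (hV : Even (Fintype.card V)) (hc : 6 ≤ Fintype.card V) {a b : V}
    (hab : a ≠ b) : IsDominatingCoclique (derangementGraph V) (withEdge a b) where
  not_adj := not_adj_of_mem_withEdge
  exists_adj := by
    classical
    intro Q₁ h₁ Q₂ h₂
    have : Nonempty V := ⟨a⟩
    obtain ⟨R, hR, hR'⟩ := exists_apply_eq_avoiding Q₁.2.1 Q₂.2.1 hV hc hab h₁ h₂
    exact ⟨R, hR, derangementGraph_adj.mpr fun x => (hR' x).1,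
      derangementGraph_adj.mpr fun x => (hR' x).2⟩

variable {F : Set (FixedPointFreeInvolution V)} {P₀ : FixedPointFreeInvolution V}

/-- Some extension of `P₀` from `A` avoids `P` off `A`. It lies in `F`, so it agrees with `P`
somewhere, necessarily in `A`. -/
theorem exists_agree_of_subset (hV : Even (Fintype.card V))
    (hF : IsDominatingCoclique (derangementGraph V) F) (A : Finset V)
    (hA : ∀ x ∈ A, P₀.1 x ∈ A) (hc : A.card + 4 ≤ Fintype.card V)
    (hAF : ∀ R : FixedPointFreeInvolution V, (∀ x ∈ A, R.1 x = P₀.1 x) → R ∈ F)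
    {P : FixedPointFreeInvolution V} (hP : P ∈ F) : ∃ x ∈ A, P.1 x = P₀.1 x := by
  classical
  have : Nonempty V := Fintype.card_pos_iff.mp (by omega)
  obtain ⟨R, hR, hR'⟩ := exists_eq_on_avoiding P.2.1 P.2.1 hV A
    (fun x hx => ⟨hA x hx, P₀.2.1 x, P₀.2.2 x⟩) (P₀.even_card_of_invariant A hA) hc
  have := hF.not_adj R (hAF R hR) P hP
  rw [derangementGraph_adj] at this
  push Not at this
  obtain ⟨x, hx⟩ := this
  have hxA : x ∈ A := by
    by_contra hxA
    exact (hR' x hxA).1 hx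
  exact ⟨x, hxA, by rw [← hx, hR x hxA]⟩

/-- Descent: split `A` into one edge of `P₀` and the rest. If both parts had extensions outside `F`,
a common neighbour in `F` would differ from `P₀` on all of `A`, against `exists_agree_of_subset`. So
one part replaces `A`, until a single edge remains and maximality of `F` applies. -/
theorem eq_withEdge_of_subset (hV : Even (Fintype.card V))
    (hF : IsDominatingCoclique (derangementGraph V) F) (A : Finset V)
    (hA : ∀ x ∈ A, P₀.1 x ∈ A) (hc : A.card + 4 ≤ Fintype.card V) (hne : A.Nonempty)
    (hAF : ∀ R : FixedPointFreeInvolution V, (∀ x ∈ A, R.1 x = P₀.1 x) → R ∈ F) :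
    ∃ a, F = withEdge a (P₀.1 a) := by
  classical
  induction A using Finset.strongInduction with
  | H A ih =>
    obtain ⟨a, ha⟩ := hne
    have hagree := fun P hP => exists_agree_of_subset (P := P) hV hF A hA hc hAF hP
    have hBA : ({a, P₀.1 a} : Finset V) ⊆ A := by
      intro x hx
      simp only [Finset.mem_insert, Finset.mem_singleton] at hx
      rcases hx with rfl | rfl
      exacts [ha, hA _ ha]
    have hB : ∀ x ∈ ({a, P₀.1 a} : Finset V), P₀.1 x ∈ ({a, P₀.1 a} : Finset V) := by
      intro x hx
      simp only [Finset.mem_insert, Finset.mem_singleton] at hx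
      rcases hx with rfl | rfl <;> simp [P₀.2.1]
    by_cases hAB : A = {a, P₀.1 a}
    · refine ⟨a, hF.eq_of_subset not_adj_of_mem_withEdge fun P hP => ?_⟩
      obtain ⟨x, hx, hPx⟩ := hagree P hP
      rw [hAB] at hx
      simp only [Finset.mem_insert, Finset.mem_singleton] at hx
      rcases hx with rfl | rfl
      · exact hPx
      · rw [P₀.2.1] at hPx
        exact P.apply_eq_comm.mp hPx
    have hBss : {a, P₀.1 a} ⊂ A := hBA.ssubset_of_ne (Ne.symm hAB)
    have hCss : A \ {a, P₀.1 a} ⊂ A :=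
      Finset.sdiff_ssubset hBA ⟨a, by simp⟩
    by_cases hBF : ∀ R : FixedPointFreeInvolution V,
        (∀ x ∈ ({a, P₀.1 a} : Finset V), R.1 x = P₀.1 x) → R ∈ F
    · exact ih _ hBss hB (by have := Finset.card_lt_card hBss; omega) ⟨a, by simp⟩ hBF
    by_cases hCF : ∀ R : FixedPointFreeInvolution V,
        (∀ x ∈ A \ {a, P₀.1 a}, R.1 x = P₀.1 x) → R ∈ F
    · refine ih _ hCss (fun x hx => ?_) (by have := Finset.card_lt_card hCss; omega)
        (Finset.sdiff_nonempty.mpr hBss.2) hCF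
      rw [Finset.mem_sdiff] at hx ⊢
      exact ⟨hA x hx.1, fun h => hx.2 (by simpa [P₀.2.1] using hB _ h)⟩
    push Not at hBF hCF
    obtain ⟨Q₁, hQ₁, hQ₁F⟩ := hBF
    obtain ⟨Q₂, hQ₂, hQ₂F⟩ := hCF
    obtain ⟨P, hP, h₁, h₂⟩ := hF.exists_adj Q₁ hQ₁F Q₂ hQ₂F
    obtain ⟨x, hx, hPx⟩ := hagree P hP
    by_cases hxB : x ∈ ({a, P₀.1 a} : Finset V)
    · exact (h₁.2 x (by rw [hPx, hQ₁ x hxB])).elim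
    · exact (h₂.2 x (by rw [hPx, hQ₂ x (Finset.mem_sdiff.mpr ⟨hx, hxB⟩)])).elim

/-- Two perfect matchings on six points which share two edges are equal. -/
theorem eq_of_agree_of_card_eq_six (hc : Fintype.card V = 6) {P Q : FixedPointFreeInvolution V}
    {x y : V} (hxy : y ≠ x) (hxy' : y ≠ P.1 x) (hx : P.1 x = Q.1 x) (hy : P.1 y = Q.1 y) :
    P = Q := by
  classical
  let S : Finset V := {x, P.1 x, y, P.1 y}
  have hPyx : P.1 y ≠ x := fun h => hxy' (P.apply_eq_comm.mp h).symm
  have hPyPx : P.1 y ≠ P.1 x := fun h => hxy (P.1.injective h)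
  have hS : S.card = 4 := Finset.card_eq_four.mpr ⟨x, P.1 x, y, P.1 y, (P.2.2 x).symm, hxy.symm,
    hPyx.symm, hxy'.symm, hPyPx.symm, (P.2.2 y).symm, rfl⟩
  have hPS : ∀ z ∈ S, P.1 z ∈ S ∧ P.1 z = Q.1 z := by
    intro z hz
    simp only [S, Finset.mem_insert, Finset.mem_singleton] at hz
    rcases hz with rfl | rfl | rfl | rfl
    · exact ⟨by simp [S], hx⟩
    · exact ⟨by simp [S, P.2.1], by rw [P.2.1, hx, Q.2.1]⟩
    · exact ⟨by simp [S], hy⟩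
    · exact ⟨by simp [S, P.2.1], by rw [P.2.1, hy, Q.2.1]⟩
  have hSc : Sᶜ.card = 2 := by rw [Finset.card_compl, hc, hS]
  obtain ⟨u, v, -, huv⟩ := Finset.card_eq_two.mp hSc
  ext z
  by_cases hz : z ∈ S
  · exact (hPS z hz).2
  have hPz : P.1 z ∈ Sᶜ := by
    rw [Finset.mem_compl]
    exact fun h => hz (by simpa [P.2.1] using (hPS _ h).1)
  have hQz : Q.1 z ∈ Sᶜ := by
    rw [Finset.mem_compl]
    intro h
    have := hPS _ h
    rw [this.2, Q.2.1] at this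
    exact hz this.1
  have hz' : z ∈ Sᶜ := Finset.mem_compl.mpr hz
  have h1 := P.2.2 z
  have h2 := Q.2.2 z
  rw [huv] at hPz hQz hz'
  simp only [Finset.mem_insert, Finset.mem_singleton] at hPz hQz hz'
  grind

/-- Here `P₀` and `P₁` share exactly one edge. A member `R` missing it meets `P₀` and `P₁` in two
further, distinct edges. The shared edge and the one common to `R` and `P₀` leave only two points,
so the edge common to `R` and `P₁` lies in `P₀` too, a contradiction. -/
theorem eq_withEdge_of_card_eq_six (hc : Fintype.card V = 6)
    (hF : IsDominatingCoclique (derangementGraph V) F) {P₁ : FixedPointFreeInvolution V}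
    (hP₀ : P₀ ∈ F) (hP₁ : P₁ ∈ F) (hne : P₀ ≠ P₁) : ∃ a, F = withEdge a (P₀.1 a) := by
  classical
  have : Nonempty V := Fintype.card_pos_iff.mp (by omega)
  obtain ⟨c, hcc⟩ := hF.exists_agree hP₀ hP₁
  refine ⟨c, hF.eq_of_subset not_adj_of_mem_withEdge fun R hR => ?_⟩
  obtain ⟨x, hx⟩ := hF.exists_agree hR hP₀
  obtain ⟨y, hy⟩ := hF.exists_agree hR hP₁
  by_contra hRc
  change R.1 c ≠ P₀.1 c at hRc
  have key : ∀ z, P₀.1 z = P₁.1 z → z = c ∨ z = P₀.1 c := by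
    intro z hz
    by_contra! h
    exact hne (eq_of_agree_of_card_eq_six hc h.1 h.2 hcc hz)
  have hxc : x ≠ c := by rintro rfl; exact hRc hx
  have hxc' : x ≠ P₀.1 c := by
    rintro rfl
    rw [P₀.2.1] at hx
    exact hRc (R.apply_eq_comm.mp hx)
  have hyc : y ≠ c := by rintro rfl; exact hRc (hy.trans hcc.symm)
  have hyc' : y ≠ P₀.1 c := by
    rintro rfl
    rw [hcc, P₁.2.1, ← hcc] at hy
    exact hRc (R.apply_eq_comm.mp hy)
  have hyx : y ≠ x := by
    rintro rfl
    rcases key y (hx.symm.trans hy) with h | h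
    exacts [hyc h, hyc' h]
  have hyx' : y ≠ P₀.1 x := by
    intro h
    rw [← hx] at h
    rw [h, R.2.1] at hy
    rcases key x (by rw [← hx]; exact P₁.apply_eq_comm.mp hy.symm |>.symm) with h | h
    exacts [hxc h, hxc' h]
  let S : Finset V := {c, P₀.1 c, x, P₀.1 x}
  have hS : Sᶜ.card ≤ 2 := by
    have h4 : S.card = 4 := Finset.card_eq_four.mpr ⟨c, P₀.1 c, x, P₀.1 x, (P₀.2.2 c).symm,
      hxc.symm, fun h => hxc' (P₀.apply_eq_comm.mp h.symm).symm, hxc'.symm,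
      fun h => hxc (P₀.1.injective h).symm, (P₀.2.2 x).symm, rfl⟩
    rw [Finset.card_compl, hc, h4]
  have hP₀S : ∀ z, z ∉ S → P₀.1 z ∉ S := by
    intro z hz hz'
    apply hz
    simp only [S, Finset.mem_insert, Finset.mem_singleton] at hz' ⊢
    rcases hz' with h | h | h | h
    · rw [P₀.apply_eq_comm] at h; simp [h]
    · simp [P₀.1.injective h]
    · rw [P₀.apply_eq_comm] at h; simp [h]
    · simp [P₀.1.injective h]
  have hyS : y ∉ S := by simp [S, hyc, hyc', hyx, hyx']
  have hRy : R.1 y ∉ S := by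
    simp only [S, Finset.mem_insert, Finset.mem_singleton, not_or]
    refine ⟨fun h => hyc' ?_, fun h => hyc ?_, fun h => hyx' ?_, fun h => hyx ?_⟩
    · rw [hcc]; rw [hy] at h; exact (P₁.apply_eq_comm.mp h).symm
    · rw [hy, hcc] at h; exact P₁.1.injective h
    · rw [← hx]; exact (R.apply_eq_comm.mp h).symm
    · rw [← hx] at h; exact R.1.injective h
  have hRP : R.1 y = P₀.1 y := by
    by_contra hne'
    have h3 : ({y, R.1 y, P₀.1 y} : Finset V).card = 3 :=
      Finset.card_eq_three.mpr ⟨_, _, _, (R.2.2 y).symm, (P₀.2.2 y).symm, hne', rfl⟩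
    have := Finset.card_le_card (s := {y, R.1 y, P₀.1 y}) (t := Sᶜ) (by
      intro z hz
      simp only [Finset.mem_insert, Finset.mem_singleton] at hz
      rw [Finset.mem_compl]
      rcases hz with rfl | rfl | rfl
      exacts [hyS, hRy, hP₀S _ hyS])
    omega
  rcases key y (hRP.symm.trans hy) with h | h
  exacts [hyc h, hyc' h]

/-- Every dominating coclique consists of the perfect matchings containing some edge. -/
theorem IsDominatingCoclique.exists_eq_withEdge (hV : Even (Fintype.card V))
    (hc : 6 ≤ Fintype.card V) (hF : IsDominatingCoclique (derangementGraph V) F) :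
    ∃ a b, a ≠ b ∧ F = withEdge a b := by
  classical
  have : Nonempty V := Fintype.card_pos_iff.mp (by omega)
  obtain ⟨P₀, hP₀⟩ : F.Nonempty := by
    by_contra hne
    rw [Set.not_nonempty_iff_eq_empty] at hne
    -- Any matching `R` will do; the identities impose no real constraint.
    obtain ⟨R, -⟩ := exists_eq_on_avoiding (f := id) (g := id) (P := id) (fun _ => rfl)
      (fun _ => rfl) hV (∅ : Finset V) (by simp) (by simp) (by simp; omega)
    obtain ⟨P, hP, -⟩ := hF.exists_adj R (by simp [hne]) R (by simp [hne])
    simp [hne] at hP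
  suffices ∃ a, F = withEdge a (P₀.1 a) from
    let ⟨a, ha⟩ := this; ⟨a, P₀.1 a, (P₀.2.2 a).symm, ha⟩
  by_contra hcon
  have hout : ∀ A : Finset V, (∀ x ∈ A, P₀.1 x ∈ A) → A.card + 4 ≤ Fintype.card V → A.Nonempty →
      ∃ R : FixedPointFreeInvolution V, (∀ x ∈ A, R.1 x = P₀.1 x) ∧ R ∉ F := by
    intro A hA hAc hne
    by_contra! h
    exact hcon (eq_withEdge_of_subset hV hF A hA hAc hne h)
  obtain ⟨a⟩ := this
  have h2 : ({a, P₀.1 a} : Finset V).card = 2 := Finset.card_pair (P₀.2.2 a).symm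
  by_cases h6 : Fintype.card V = 6
  · obtain ⟨R, hR, hRF⟩ := hout {a, P₀.1 a} (by simp [P₀.2.1]) (by omega) ⟨a, by simp⟩
    obtain ⟨P₁, hP₁, hadj, -⟩ := hF.exists_adj R hRF R hRF
    refine hcon (eq_withEdge_of_card_eq_six h6 hF hP₀ hP₁ ?_)
    rintro rfl
    exact hadj.2 a (hR a (by simp)).symm
  -- With eight points, two edges of `P₀` and their complement both leave out at least four points.
  -- Both thus extend outside `F`, and a common neighbour in `F` would agree with `P₀` nowhere.
  · have h8 : 8 ≤ Fintype.card V := by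
      obtain ⟨i, hi⟩ := hV
      omega
    obtain ⟨b, -, hb⟩ := Finset.exists_mem_notMem_of_card_lt_card (s := {a, P₀.1 a})
      (t := (Finset.univ : Finset V)) (by rw [Finset.card_univ]; omega)
    simp only [Finset.mem_insert, Finset.mem_singleton, not_or] at hb
    have hb' : P₀.1 b ≠ a := fun h => hb.2 (P₀.apply_eq_comm.mp h).symm
    have h4 : ({a, P₀.1 a, b, P₀.1 b} : Finset V).card = 4 :=
      Finset.card_eq_four.mpr ⟨_, _, _, _, (P₀.2.2 a).symm, Ne.symm hb.1, hb'.symm, Ne.symm hb.2,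
        fun h => hb.1 (P₀.1.injective h).symm, (P₀.2.2 b).symm, rfl⟩
    have hS : ∀ x ∈ ({a, P₀.1 a, b, P₀.1 b} : Finset V),
        P₀.1 x ∈ ({a, P₀.1 a, b, P₀.1 b} : Finset V) := by simp [P₀.2.1]
    obtain ⟨Q₁, hQ₁, hQ₁F⟩ := hout {a, P₀.1 a, b, P₀.1 b} hS (by omega) ⟨a, by simp⟩
    have hcompl := Finset.card_compl ({a, P₀.1 a, b, P₀.1 b} : Finset V)
    obtain ⟨Q₂, hQ₂, hQ₂F⟩ := hout {a, P₀.1 a, b, P₀.1 b}ᶜ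
      (fun x hx => by
        rw [Finset.mem_compl] at hx ⊢
        exact fun h => hx (by simpa only [P₀.2.1] using hS _ h))
      (by omega) (Finset.card_pos.mp (by omega))
    obtain ⟨P, hP, h₁, h₂⟩ := hF.exists_adj Q₁ hQ₁F Q₂ hQ₂F
    have : Nonempty V := ⟨a⟩
    obtain ⟨x, hx⟩ := hF.exists_agree hP hP₀
    by_cases hxS : x ∈ ({a, P₀.1 a, b, P₀.1 b} : Finset V)
    · exact h₁.2 x (by rw [hx, hQ₁ x hxS])
    · exact h₂.2 x (by rw [hx, hQ₂ x (Finset.mem_compl.mpr hxS)])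

end Classification

/-! ### The action of the symmetric group -/

/-- The image of a perfect matching under a permutation of the points. -/
def conj (σ : Equiv.Perm V) (P : FixedPointFreeInvolution V) : FixedPointFreeInvolution V :=
  ⟨σ * P.1 * σ⁻¹, fun x => by simp [P.2.1], fun x h => P.2.2 (σ⁻¹ x) (by
    rw [Equiv.Perm.eq_inv_iff_eq]; simpa using h)⟩

theorem conj_val_apply (σ : Equiv.Perm V) (P : FixedPointFreeInvolution V) (x : V) :
    (conj σ P).1 x = σ (P.1 (σ⁻¹ x)) := rfl

theorem conj_one (P : FixedPointFreeInvolution V) : conj 1 P = P := by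
  ext x; simp [conj_val_apply]

theorem conj_mul (σ τ : Equiv.Perm V) (P : FixedPointFreeInvolution V) :
    conj (σ * τ) P = conj σ (conj τ P) := by
  ext x; simp [conj_val_apply]

theorem conj_mem_withEdge {σ : Equiv.Perm V} {P : FixedPointFreeInvolution V} {a b : V} :
    conj σ P ∈ withEdge (σ a) (σ b) ↔ P ∈ withEdge a b := by
  simp [withEdge, conj_val_apply]

/-- The permutations of `V` act on the derangement graph. -/
def conjHom (V : Type*) : Equiv.Perm V →* (derangementGraph V ≃g derangementGraph V) where
  toFun σ :=
    { toFun := conj σ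
      invFun := conj σ⁻¹
      left_inv := fun P => by rw [← conj_mul, inv_mul_cancel, conj_one]
      right_inv := fun P => by rw [← conj_mul, mul_inv_cancel, conj_one]
      map_rel_iff' := by
        intro P Q
        have hinj : Function.Injective (conj σ) := fun P Q h => by
          rw [← conj_one P, ← conj_one Q, ← inv_mul_cancel σ, conj_mul, conj_mul, h]
        refine and_congr hinj.ne_iff ⟨fun h x hx => h (σ x) ?_, fun h x hx => h (σ⁻¹ x) ?_⟩
        · simp [conj_val_apply, hx]
        · exact σ.injective hx }
  map_one' := RelIso.ext conj_one
  map_mul' σ τ := RelIso.ext (conj_mul σ τ)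

variable [Fintype V]

theorem eq_of_withEdge_subset (hV : Even (Fintype.card V)) (hc : 6 ≤ Fintype.card V) {a b c d : V}
    (hab : a ≠ b) (h : withEdge a b ⊆ withEdge c d) : s(a, b) = s(c, d) := by
  classical
  by_contra hne
  have hs : Equiv.swap c d a ≠ b := by
    intro hs
    apply hne
    rw [Equiv.swap_apply_def] at hs
    split_ifs at hs with h1 h2
    · rw [h1, hs]
    · rw [h2, hs, Sym2.eq_swap]
    · exact (hab hs).elim
  -- The transposition is the partial matching with sole edge `{c, d}`, so `R` contains `{a, b}` but
  -- not `{c, d}`.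
  obtain ⟨R, hR, hR'⟩ := exists_apply_eq_avoiding (f := Equiv.swap c d) (g := Equiv.swap c d)
    (by simp) (by simp) hV hc hab hs hs
  exact (hR' c).1 (by rw [Equiv.swap_apply_left]; exact h hR)

theorem withEdge_nonempty (hV : Even (Fintype.card V)) (hc : 6 ≤ Fintype.card V) {a b : V}
    (hab : a ≠ b) : (withEdge a b).Nonempty := by
  classical
  obtain ⟨R, hR, -⟩ := exists_apply_eq_avoiding (f := id) (g := id) (fun _ => rfl) (fun _ => rfl)
    hV hc hab hab hab
  exact ⟨R, hR⟩

theorem withEdge_inter_nonempty (hV : Even (Fintype.card V)) (hc : 6 ≤ Fintype.card V)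
    {a b c d : V} (hab : a ≠ b) (hcd : c ≠ d) (hac : a ≠ c) (had : a ≠ d) (hbc : b ≠ c)
    (hbd : b ≠ d) : (withEdge a b ∩ withEdge c d).Nonempty := by
  classical
  obtain ⟨P, hP⟩ := withEdge_nonempty hV hc hab
  have hPa : P.1 a = b := hP
  have hPb : P.1 b = a := P.apply_eq_comm.mp hPa
  have hca : P.1 c ≠ a := fun h => hbc (hPa.symm.trans (P.apply_eq_comm.mp h))
  have hcb : P.1 c ≠ b := fun h => hac (hPb.symm.trans (P.apply_eq_comm.mp h))
  -- This transposition fixes `a`, `b`, `c` and moves the partner of `c` to `d`.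
  refine ⟨conj (Equiv.swap (P.1 c) d) P, ?_, ?_⟩
  · change _ = _
    rw [conj_val_apply, Equiv.swap_inv, Equiv.swap_apply_of_ne_of_ne hca.symm had, hPa,
      Equiv.swap_apply_of_ne_of_ne hcb.symm hbd]
  · change _ = _
    rw [conj_val_apply, Equiv.swap_inv, Equiv.swap_apply_of_ne_of_ne (P.2.2 c).symm hcd,
      Equiv.swap_apply_left]

theorem exists_image_withEdge (hV : Even (Fintype.card V)) (hc : 6 ≤ Fintype.card V)
    (φ : derangementGraph V ≃g derangementGraph V) {a b : V} (hab : a ≠ b) :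
    ∃ c d, c ≠ d ∧ φ '' withEdge a b = withEdge c d :=
  ((isDominatingCoclique_withEdge hV hc hab).image φ).exists_eq_withEdge hV hc

/-- The edges at `a` are mapped to edges at a single point. -/
theorem exists_image_center (hV : Even (Fintype.card V)) (hc : 6 ≤ Fintype.card V)
    (φ : derangementGraph V ≃g derangementGraph V) (a : V) :
    ∃ x, ∀ b, a ≠ b → ∃ y, x ≠ y ∧ φ '' withEdge a b = withEdge x y := by
  classical
  have himg : ∀ b, ∃ p : V × V, a ≠ b → p.1 ≠ p.2 ∧ φ '' withEdge a b = withEdge p.1 p.2 := by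
    intro b
    by_cases hab : a = b
    · exact ⟨(a, a), fun h => (h hab).elim⟩
    · obtain ⟨c, d, h⟩ := exists_image_withEdge hV hc φ hab
      exact ⟨(c, d), fun _ => h⟩
  choose p hp using himg
  -- No matching contains two edges at `a`, so the image families are disjoint and the image edges
  -- must meet.
  have hdisj : ∀ b, a ≠ b → ∀ b', a ≠ b' → b ≠ b' →
      ¬ (withEdge (p b).1 (p b).2 ∩ withEdge (p b').1 (p b').2).Nonempty := by
    intro b hb b' hb' hbb' hne
    rw [← (hp b hb).2, ← (hp b' hb').2, ← Set.image_inter φ.injective, Set.image_nonempty] at hne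
    obtain ⟨P, hP, hP'⟩ := hne
    exact hbb' (Eq.trans (Eq.symm hP) hP')
  obtain ⟨x, hx⟩ := Sym2.exists_mem_of_pairwise_meet (Finset.univ.erase a)
    (by rw [Finset.card_erase_of_mem (Finset.mem_univ a), Finset.card_univ]; omega)
    (fun b => s((p b).1, (p b).2))
    (by
      intro b hb b' hb' hbb' h
      have hb := (Finset.ne_of_mem_erase hb).symm
      apply hdisj b hb b' (Finset.ne_of_mem_erase hb').symm hbb'
      rw [← withEdge_congr h, Set.inter_self]
      exact withEdge_nonempty hV hc (hp b hb).1)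
    (by
      intro b hb b' hb' hbb'
      have hb := (Finset.ne_of_mem_erase hb).symm
      have hb' := (Finset.ne_of_mem_erase hb').symm
      by_contra! h
      simp only [Sym2.mem_iff] at h
      have h1 := h _ (Or.inl rfl)
      have h2 := h _ (Or.inr rfl)
      push Not at h1 h2
      exact hdisj b hb b' hb' hbb' (withEdge_inter_nonempty hV hc (hp b hb).1 (hp b' hb').1
        h1.1 h1.2 h2.1 h2.2))
  refine ⟨x, fun b hb => ?_⟩
  obtain ⟨y, hy⟩ := Sym2.mem_iff_exists.mp (hx b (by simp [Ne.symm hb]))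
  have := hp b hb
  refine ⟨y, ?_, this.2.trans (withEdge_congr hy)⟩
  rcases Sym2.eq_iff.mp hy with ⟨h1, h2⟩ | ⟨h1, h2⟩
  · rw [← h1, ← h2]; exact this.1
  · rw [← h1, ← h2]; exact this.1.symm

theorem conjHom_injective (hV : Even (Fintype.card V)) (hc : 6 ≤ Fintype.card V) :
    Function.Injective (conjHom V) := by
  classical
  rw [injective_iff_map_eq_one]
  intro σ hσ
  have hfix : ∀ P, conj σ P = P := fun P => DFunLike.congr_fun hσ P
  have hedge : ∀ a b, a ≠ b → s(a, b) = s(σ a, σ b) := fun a b hab =>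
    eq_of_withEdge_subset hV hc hab fun P hP => by
      rw [← hfix P]
      exact conj_mem_withEdge.mpr hP
  ext a
  by_contra hne
  obtain ⟨b, -, hb⟩ := Finset.exists_mem_notMem_of_card_lt_card (s := {a, σ a})
    (t := (Finset.univ : Finset V))
    (by rw [Finset.card_univ]; exact Finset.card_le_two.trans_lt (by omega))
  simp only [Finset.mem_insert, Finset.mem_singleton, not_or] at hb
  rcases Sym2.eq_iff.mp (hedge a b (Ne.symm hb.1)) with h | h
  · exact hne h.1.symm
  · exact hb.2 h.2

theorem conjHom_surjective (hV : Even (Fintype.card V)) (hc : 6 ≤ Fintype.card V) :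
    Function.Surjective (conjHom V) := by
  classical
  intro φ
  choose σ hσ using exists_image_center hV hc φ
  -- If `σ a = σ b`, a matching with disjoint edges `{a, c}` and `{b, d}` has an image in which both
  -- become the edge at `σ a`, forcing these edges to be equal.
  have hinj : Function.Injective σ := by
    intro a b hab
    by_contra hne
    obtain ⟨c, -, hcm⟩ := Finset.exists_mem_notMem_of_card_lt_card (s := {a, b})
      (t := (Finset.univ : Finset V))
      (by rw [Finset.card_univ]; exact Finset.card_le_two.trans_lt (by omega))
    obtain ⟨d, -, hdm⟩ := Finset.exists_mem_notMem_of_card_lt_card (s := {a, b, c})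
      (t := (Finset.univ : Finset V))
      (by rw [Finset.card_univ]; exact Finset.card_le_three.trans_lt (by omega))
    simp only [Finset.mem_insert, Finset.mem_singleton, not_or] at hcm hdm
    obtain ⟨y, -, hy⟩ := hσ a c (Ne.symm hcm.1)
    obtain ⟨z, -, hz⟩ := hσ b d (Ne.symm hdm.2.1)
    obtain ⟨P, hP, hP'⟩ := withEdge_inter_nonempty hV hc (Ne.symm hcm.1) (Ne.symm hdm.2.1) hne
      (Ne.symm hdm.1) hcm.2 (Ne.symm hdm.2.2)
    have h1 : φ P ∈ withEdge (σ a) y := hy ▸ ⟨P, hP, rfl⟩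
    have h2 : φ P ∈ withEdge (σ b) z := hz ▸ ⟨P, hP', rfl⟩
    have hyz : y = z := by
      rw [← hab] at h2
      exact Eq.trans (Eq.symm h1) h2
    have himg : φ '' withEdge a c = φ '' withEdge b d := by rw [hy, hz, hab, hyz]
    rcases Sym2.eq_iff.mp (eq_of_withEdge_subset hV hc (Ne.symm hcm.1)
      (φ.injective.image_injective himg).le) with h | h
    · exact hne h.1
    · exact hdm.1 h.1.symm
  let τ : Equiv.Perm V := Equiv.ofBijective σ (Finite.injective_iff_bijective.mp hinj)
  refine ⟨τ, RelIso.ext fun P => ?_⟩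
  change conj τ P = φ P
  ext x
  obtain ⟨a, rfl⟩ := τ.surjective x
  have hne : a ≠ P.1 a := (P.2.2 a).symm
  obtain ⟨y, hy, himg⟩ := hσ a (P.1 a) hne
  obtain ⟨z, hz, himg'⟩ := hσ (P.1 a) a hne.symm
  rw [withEdge_comm, himg] at himg'
  -- The image of the edge `{a, P.1 a}` is seen from both ends, so it joins `σ a` to `σ (P.1 a)`.
  have hyz : y = σ (P.1 a) := by
    rcases Sym2.eq_iff.mp (eq_of_withEdge_subset hV hc hy himg'.le) with h | h
    · exact (hne (hinj h.1)).elim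
    · exact h.2
  have hmem : φ P ∈ withEdge (σ a) y := himg ▸ ⟨P, rfl, rfl⟩
  have hmem' : (φ P).1 (σ a) = y := hmem
  have hτ : τ⁻¹ (τ a) = a := τ.symm_apply_apply a
  rw [conj_val_apply, hτ]
  change σ (P.1 a) = (φ P).1 (σ a)
  rw [hmem', hyz]

end FixedPointFreeInvolution

/-! ### Transfer to perfect matchings -/

/-- Perfect matchings of the complete graph correspond to fixed-point-free involutions of its
vertices, and the derangement graphs agree. -/
theorem nonempty_matchingDerangementGraph_iso (k : ℕ) :
    Nonempty (matchingDerangementGraph k ≃g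
      FixedPointFreeInvolution.derangementGraph (Fin (2 * k))) := by
  classical
  have hex : ∀ (P : PerfectMatching k) (v : Fin (2 * k)), ∃ w, P.1.Adj v w := fun P v =>
    (P.2.1 (P.2.2 v)).exists
  choose m hm using hex
  have huniq : ∀ (P : PerfectMatching k) v w, P.1.Adj v w ↔ m P v = w := fun P v w =>
    ⟨fun h => P.2.1.eq_of_adj_left (hm P v) h, fun h => h ▸ hm P v⟩
  have hinv : ∀ P : PerfectMatching k, Function.Involutive (m P) := fun P v =>
    (huniq P _ _).mp (hm P v).symm
  let toInv : PerfectMatching k → FixedPointFreeInvolution (Fin (2 * k)) := fun P =>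
    ⟨(hinv P).toPerm, hinv P, fun v => (hm P v).ne.symm⟩
  have hto : ∀ P v, (toInv P).1 v = m P v := fun _ _ => rfl
  have hbij : Function.Bijective toInv := by
    constructor
    · intro P Q h
      have hPQ : m P = m Q := funext fun v => by rw [← hto, ← hto, h]
      apply Subtype.ext
      ext v w
      · simp [P.2.2 v, Q.2.2 v]
      · rw [huniq, huniq, hPQ]
    · intro f
      let S : (SimpleGraph.completeGraph (Fin (2 * k))).Subgraph :=
        { verts := Set.univ
          Adj := fun v w => f.1 v = w
          adj_sub := by
            rintro v _ rfl
            exact (f.2.2 v).symm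
          edge_vert := fun _ => Set.mem_univ _
          symm := ⟨fun v w h => f.apply_eq_comm.mp h⟩ }
      have hS : S.IsPerfectMatching := ⟨fun v _ => ⟨f.1 v, rfl, fun w hw => Eq.symm hw⟩,
        fun v => Set.mem_univ v⟩
      refine ⟨⟨S, hS⟩, ?_⟩
      ext v
      rw [hto, (huniq ⟨S, hS⟩ v (f.1 v)).mp rfl]
  refine ⟨⟨Equiv.ofBijective toInv hbij, ?_⟩⟩
  intro P Q
  refine and_congr hbij.1.ne_iff ?_
  simp only [Equiv.ofBijective_apply, hto]
  rw [Set.disjoint_left]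
  constructor
  · intro h e
    induction e with
    | h v w =>
      rw [SimpleGraph.Subgraph.mem_edgeSet, SimpleGraph.Subgraph.mem_edgeSet, huniq, huniq]
      exact fun h1 h2 => h v (h1.trans h2.symm)
  · intro h v hv
    refine h (a := s(v, m P v)) (hm P v) ?_
    rw [hv]
    exact hm Q v

/-- Isomorphic graphs have isomorphic automorphism groups. -/
def SimpleGraph.Iso.autCongr {α β : Type*} {G : SimpleGraph α} {H : SimpleGraph β} (e : G ≃g H) :
    (G ≃g G) ≃* (H ≃g H) where
  toFun φ := (e.symm.trans φ).trans e
  invFun ψ := (e.trans ψ).trans e.symm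
  left_inv φ := RelIso.ext fun x => by simp
  right_inv ψ := RelIso.ext fun x => by simp
  map_mul' φ ψ := RelIso.ext fun x => by simp

theorem mainTheorem5 (k : ℕ) (hk : 3 ≤ k) :
    Nonempty ((matchingDerangementGraph k ≃g matchingDerangementGraph k) ≃*
      Equiv.Perm (Fin (2 * k))) := by
  obtain ⟨e⟩ := nonempty_matchingDerangementGraph_iso k
  have hV : Even (Fintype.card (Fin (2 * k))) := by simp
  have hc : 6 ≤ Fintype.card (Fin (2 * k)) := by rw [Fintype.card_fin]; omega
  exact ⟨(SimpleGraph.Iso.autCongr e).trans (MulEquiv.ofBijective (FixedPointFreeInvolution.conjHom _)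
    ⟨FixedPointFreeInvolution.conjHom_injective hV hc,
      FixedPointFreeInvolution.conjHom_surjective hV hc⟩).symm⟩
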